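/- For $\sigma>0$ let $B_\sigma=\{f\in L^2(\mathbb R) : \operatorname{supp}\widehat f\subseteq[-\sigma,\sigma]\}$, where $\widehat f(\xi)=\int_{-\infty}^{\infty}f(x)e^{-ix\xi}\,dx$ (extended to $L^2(\mathbb R)$ in the usual way), functions being complex valued and each element of $B_\sigma$ being identified with its continuous (in fact entire) representative. Let $\tau$ be the smallest positive root of the equation $\tanh\left(\frac{\pi\tau^{1/4}}{2}\right)+\tan\left(\frac{\pi\tau^{1/4}}{2}\right)=0$. Let $\sigma>0$, let $(x_j)_{j\in\mathbb Z}$ be a strictly increasing sequence of real numbers, and let $f\in B_\sigma$ satisfy $f(x_j)=f'(x_j)=0$ for all $j\in\mathbb Z$. If $\sup_{j\in\mathbb Z}(x_{j+1}-x_j)\le\frac{\pi}{\sigma}\tau^{1/4}$, then $f\equiv 0$. -/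

import Mathlib

open MeasureTheory Set
open scoped FourierTransform

noncomputable section

/-- The positive real numbers `t` with `tanh (π t^{1/4} / 2) + tan (π t^{1/4} / 2) = 0`.
(`t = 0` is a trivial solution and is excluded.) -/
def tauRoots : Set ℝ :=
  {t : ℝ | 0 < t ∧
    Real.tanh (Real.pi * t ^ (1 / 4 : ℝ) / 2) + Real.tan (Real.pi * t ^ (1 / 4 : ℝ) / 2) = 0}

/-- The constant `τ`: the smallest positive root of
`tanh (π τ^{1/4} / 2) + tan (π τ^{1/4} / 2) = 0`
(it is attained, see `isLeast_tau`). -/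
def tau : ℝ := sInf tauRoots

/-- The smallest positive root exists, and `tau` is that root. -/
theorem isLeast_tau : IsLeast tauRoots tau := by
  set T : ℝ → ℝ := fun t => Real.pi * t ^ (1 / 4 : ℝ) / 2 with hT
  have hTc : Continuous T := by
    have h : Continuous fun t : ℝ => t ^ (1 / 4 : ℝ) :=
      Real.continuous_rpow_const (by norm_num)
    exact (continuous_const.mul h).div_const 2
  set G : ℝ → ℝ := fun t =>
    Real.sinh (T t) * Real.cos (T t) + Real.sin (T t) * Real.cosh (T t) with hG
  have hGc : Continuous G := by
    have h1 := Real.continuous_sinh.comp hTc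
    have h2 := Real.continuous_cosh.comp hTc
    have h3 := Real.continuous_sin.comp hTc
    have h4 := Real.continuous_cos.comp hTc
    exact (h1.mul h4).add (h3.mul h2)
  have hT1 : T 1 = Real.pi / 2 := by simp [hT]
  have hT16 : T 16 = Real.pi := by
    have : (16 : ℝ) ^ (1 / 4 : ℝ) = 2 := by
      rw [show (16 : ℝ) = 2 ^ (4 : ℝ) by norm_num, ← Real.rpow_mul (by norm_num)]
      norm_num
    simp only [hT, this]; ring
  have hmono : ∀ s t : ℝ, 0 ≤ s → s ≤ t → T s ≤ T t := by
    intro s t hs hst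
    have : s ^ (1 / 4 : ℝ) ≤ t ^ (1 / 4 : ℝ) := Real.rpow_le_rpow hs hst (by norm_num)
    have := mul_le_mul_of_nonneg_left this Real.pi_pos.le
    simp only [hT]; linarith
  have hTpos : ∀ t : ℝ, 0 < t → 0 < T t := fun t ht => by
    have := Real.rpow_pos_of_pos ht (1 / 4 : ℝ)
    have := mul_pos Real.pi_pos this
    simp only [hT]; linarith
  -- on `(0, 16]` a root lies beyond `1`, and roots are the zeros of `G`
  have hroot : ∀ t : ℝ, t ∈ tauRoots → t ∈ Icc (0 : ℝ) 16 → 1 ≤ t ∧ G t = 0 := by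
    rintro t ⟨ht, h⟩ -
    have hp := hTpos t ht
    have htanh : 0 < Real.tanh (T t) := by
      rw [Real.tanh_eq_sinh_div_cosh]
      exact div_pos (Real.sinh_pos_iff.2 hp) (Real.cosh_pos _)
    have h' : Real.tanh (T t) + Real.tan (T t) = 0 := h
    refine ⟨?_, ?_⟩
    · by_contra! hlt
      have hle : T t ≤ Real.pi / 2 := hT1 ▸ hmono t 1 ht.le hlt.le
      have : 0 ≤ Real.tan (T t) := Real.tan_nonneg_of_nonneg_of_le_pi_div_two hp.le hle
      linarith
    · have hcos : Real.cos (T t) ≠ 0 := by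
        intro hc
        rw [Real.tan_eq_sin_div_cos, hc, div_zero] at h'
        linarith
      rw [Real.tanh_eq_sinh_div_cosh, Real.tan_eq_sin_div_cos] at h'
      have hch := (Real.cosh_pos (T t)).ne'
      field_simp at h'
      simp only [hG]; linarith
  have hconv : ∀ t ∈ Icc (1 : ℝ) 16, G t = 0 → t ∈ tauRoots := by
    rintro t ⟨h1, -⟩ h
    have hp := hTpos t (by linarith)
    refine ⟨by linarith, ?_⟩
    change Real.tanh (T t) + Real.tan (T t) = 0
    have hcos : Real.cos (T t) ≠ 0 := by
      intro hc
      have hch := (Real.cosh_pos (T t)).ne'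
      have hs : Real.sin (T t) = 0 := by
        simp only [hG, hc] at h
        simpa [hch] using h
      have := Real.sin_sq_add_cos_sq (T t)
      rw [hs, hc] at this
      norm_num at this
    have hch := (Real.cosh_pos (T t)).ne'
    rw [Real.tanh_eq_sinh_div_cosh, Real.tan_eq_sin_div_cos]
    field_simp
    simp only [hG] at h; linarith
  have hK : IsCompact (Icc (1 : ℝ) 16 ∩ G ⁻¹' {0}) :=
    isCompact_Icc.inter_right (isClosed_singleton.preimage hGc)
  have hne : (Icc (1 : ℝ) 16 ∩ G ⁻¹' {0}).Nonempty := by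
    have h0 : (0 : ℝ) ∈ Icc (G 16) (G 1) := by
      constructor
      · simp only [hG, hT16]; simp [Real.pi_pos.le]
      · simp only [hG, hT1]; simp [(Real.cosh_pos _).le]
    obtain ⟨t, ht, h⟩ := intermediate_value_Icc' (by norm_num : (1 : ℝ) ≤ 16) hGc.continuousOn h0
    exact ⟨t, ht, h⟩
  obtain ⟨m, ⟨hm, hm0⟩, hleast⟩ := hK.exists_isLeast hne
  have hL : IsLeast tauRoots m := by
    refine ⟨hconv m hm hm0, fun t ht => ?_⟩
    by_contra! hlt
    have h16 : t ∈ Icc (0 : ℝ) 16 := ⟨ht.1.le, hlt.le.trans hm.2⟩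
    obtain ⟨h1, h2⟩ := hroot t ht h16
    exact absurd (hleast ⟨⟨h1, h16.2⟩, h2⟩) (not_le.2 hlt)
  have : tau = m := hL.csInf_eq
  rw [this]; exact hL

/-- The `L²` Fourier transform in angular frequency, i.e. the extension to `L²(ℝ)` of
`ĝ(ω) = ∫ g(x) e^{-i x ω} dx`. Mathlib's `𝓕` is the extension of
`ξ ↦ ∫ g(x) e^{-2 π i x ξ} dx`, so `ĝ(ω) = (𝓕 g)(ω / 2π)`. -/
def angularFourier (g : Lp ℂ 2 (volume : Measure ℝ)) : ℝ → ℂ :=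
  fun ω => (𝓕 g : Lp ℂ 2 (volume : Measure ℝ)) (ω / (2 * Real.pi))

/-- The space `B_σ` of `σ`-band limited functions: the `f ∈ L²(ℝ)` with
`supp f̂ ⊆ [-σ, σ]` (that is, `f̂ = 0` almost everywhere outside `[-σ, σ]`). Each such class
is represented by its (unique) continuous representative, so that point values make sense. -/
def Bandlimited (σ : ℝ) : Set (ℝ → ℂ) :=
  {f | Continuous f ∧ ∃ hf : MemLp f 2 (volume : Measure ℝ),
    ∀ᵐ ω : ℝ, ω ∉ Icc (-σ) σ → angularFourier (hf.toLp f) ω = 0}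

end

/-! Each gap between consecutive double zeros is a clamped interval: `f` and `f'` vanish at both
ends. The sharp constant in `∫ |u''|² ≥ κ⁴ ∫ |u|²` for clamped `u` is governed by the first zero of
the beam determinant `1 - cosh t cos t`, which is `π τ^{1/4}`. The gap bound therefore yields the
inequality on every gap for each `κ < σ`. Summing over the gaps and letting `κ → σ` gives `‖f''‖₂² ≥
σ⁴ ‖f‖₂²`.

By Plancherel, band-limitation forces the opposite inequality, strictly unless the spectrum vanishes
almost everywhere, since `|ω| < σ` for almost every `ω` in the band. Hence `f = 0`. If the nodes do
not exhaust the line, they accumulate at a finite point and the identity theorem for entire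
functions applies instead.

The Wirtinger inequality (`clamped_wirtinger`) is proved by completing a square, with coefficients
from the beam equation `u'''' = κ⁴ u`. -/

/-! ### Zeros of the clamped beam determinant. -/

/-- Positive zeros of `sinh t cos t + sin t cosh t` are bounded below by `π τ^{1/4} / 2`. -/
theorem tau_le_of_beam_root {t : ℝ} (ht : 0 < t)
    (h : Real.sinh t * Real.cos t + Real.sin t * Real.cosh t = 0) :
    Real.pi * tau ^ (1 / 4 : ℝ) / 2 ≤ t := by
  have hch := Real.cosh_pos t
  have hcos : Real.cos t ≠ 0 := by
    intro hc
    have hs : Real.sin t = 0 := by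
      rw [hc] at h
      simpa [hch.ne'] using h
    have := Real.sin_sq_add_cos_sq t
    rw [hs, hc] at this
    norm_num at this
  have hpi := Real.pi_pos
  have hb : 0 < 2 * t / Real.pi := by positivity
  have hroot : ((2 * t / Real.pi) ^ 4) ^ (1 / 4 : ℝ) = 2 * t / Real.pi := by
    rw [← Real.rpow_natCast, ← Real.rpow_mul hb.le]
    norm_num
  have harg : Real.pi * ((2 * t / Real.pi) ^ 4) ^ (1 / 4 : ℝ) / 2 = t := by
    rw [hroot]; field_simp
  have hmem : (2 * t / Real.pi) ^ 4 ∈ tauRoots := by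
    refine ⟨by positivity, ?_⟩
    rw [harg, Real.tanh_eq_sinh_div_cosh, Real.tan_eq_sin_div_cos]
    field_simp
    linarith
  have hle : tau ≤ (2 * t / Real.pi) ^ 4 := isLeast_tau.2 hmem
  have h0 : 0 < tau := isLeast_tau.1.1
  have := Real.rpow_le_rpow h0.le hle (by norm_num : (0 : ℝ) ≤ 1 / 4)
  calc Real.pi * tau ^ (1 / 4 : ℝ) / 2
      ≤ Real.pi * ((2 * t / Real.pi) ^ 4) ^ (1 / 4 : ℝ) / 2 := by gcongr
    _ = t := harg

/-- Before the first root, `sinh t cos t + sin t cosh t` is positive. -/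
theorem beam_pos {t : ℝ} (ht : 0 < t) (hlt : t < Real.pi * tau ^ (1 / 4 : ℝ) / 2) :
    0 < Real.sinh t * Real.cos t + Real.sin t * Real.cosh t := by
  by_contra! hneg
  have hpi := Real.pi_pos
  set G : ℝ → ℝ := fun t => Real.sinh t * Real.cos t + Real.sin t * Real.cosh t with hG
  have hGc : Continuous G := by
    have h1 := Real.continuous_sinh
    have h2 := Real.continuous_cosh
    fun_prop
  have hsmall : ∀ s : ℝ, 0 < s → s ≤ Real.pi / 2 → 0 < G s := fun s hs hs2 => by
    have h1 : 0 ≤ Real.cos s := Real.cos_nonneg_of_mem_Icc ⟨by linarith, hs2⟩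
    have h2 : 0 < Real.sin s := Real.sin_pos_of_pos_of_lt_pi hs (by linarith)
    have h3 : 0 < Real.sinh s := Real.sinh_pos_iff.2 hs
    have h4 := Real.cosh_pos s
    simp only [hG]; positivity
  have htbig : Real.pi / 2 ≤ t := by
    by_contra! h
    exact absurd (hsmall t ht h.le) (not_lt.2 hneg)
  obtain ⟨s, hs, hs0⟩ := intermediate_value_Icc' htbig hGc.continuousOn
    (⟨hneg, (hsmall _ (by positivity) le_rfl).le⟩ : (0 : ℝ) ∈ Icc (G t) (G (Real.pi / 2)))
  have := tau_le_of_beam_root (by linarith [hs.1]) hs0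
  linarith [hs.2]

/-- At `t = π` the expression of `beam_pos` equals `-sinh π < 0`. This keeps the range needed below
inside that of `sin_mul_cosh_sub_pos`. -/
theorem pi_mul_tau_rpow_div_two_le_pi : Real.pi * tau ^ (1 / 4 : ℝ) / 2 ≤ Real.pi := by
  by_contra! h
  have := beam_pos Real.pi_pos h
  have h2 := Real.sinh_pos_iff.2 Real.pi_pos
  rw [Real.sin_pi, Real.cos_pi] at this
  linarith

/-- The function vanishes at `0` and has derivative `2 sin s sinh s`, positive on `(0, π)`. -/
theorem sin_mul_cosh_sub_pos {t : ℝ} (ht : 0 < t) (hpi : t ≤ Real.pi) :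
    0 < Real.sin t * Real.cosh t - Real.sinh t * Real.cos t := by
  have hd : ∀ s, HasDerivAt (fun s => Real.sin s * Real.cosh s - Real.sinh s * Real.cos s)
      (2 * (Real.sin s * Real.sinh s)) s := fun s => by
    refine (((Real.hasDerivAt_sin s).fun_mul (Real.hasDerivAt_cosh s)).fun_sub
      ((Real.hasDerivAt_sinh s).fun_mul (Real.hasDerivAt_cos s))).congr_deriv ?_
    ring
  have hmono : StrictMonoOn (fun s => Real.sin s * Real.cosh s - Real.sinh s * Real.cos s)
      (Icc 0 Real.pi) := by
    refine strictMonoOn_of_deriv_pos (convex_Icc _ _)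
      (fun s _ => (hd s).continuousAt.continuousWithinAt) fun s hs => ?_
    rw [interior_Icc] at hs
    rw [(hd s).deriv]
    have := Real.sin_pos_of_pos_of_lt_pi hs.1 hs.2
    have := Real.sinh_pos_iff.2 hs.1
    positivity
  simpa using hmono ⟨le_rfl, Real.pi_pos.le⟩ ⟨ht.le, hpi⟩ ht

/-- The clamped beam determinant `1 - cosh t cos t` is positive before its first positive zero. -/
theorem one_sub_cosh_mul_cos_pos {t : ℝ} (ht : 0 < t)
    (hlt : t < Real.pi * tau ^ (1 / 4 : ℝ)) : 0 < 1 - Real.cosh t * Real.cos t := by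
  obtain ⟨s, rfl⟩ : ∃ s, t = 2 * s := ⟨t / 2, by ring⟩
  have hs : 0 < s := by linarith
  have hs' : s < Real.pi * tau ^ (1 / 4 : ℝ) / 2 := by linarith
  have h1 := beam_pos hs hs'
  have h2 := sin_mul_cosh_sub_pos hs (by linarith [pi_mul_tau_rpow_div_two_le_pi])
  have h3 := mul_pos h1 h2
  have e1 := Real.cosh_two_mul s
  have e2 := Real.cos_two_mul s
  have e3 := Real.cosh_sq s
  have e4 := Real.sin_sq_add_cos_sq s
  rw [e1, e2]
  -- Half-angle factorization: the first factor belongs to the modes even about the midpoint, the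
  -- second to the odd ones. The even factor vanishes first.
  have : 1 - (Real.cosh s ^ 2 + Real.sinh s ^ 2) * (2 * Real.cos s ^ 2 - 1) =
      2 * ((Real.sinh s * Real.cos s + Real.sin s * Real.cosh s) *
        (Real.sin s * Real.cosh s - Real.sinh s * Real.cos s)) := by
    have e5 : Real.sin s ^ 2 = 1 - Real.cos s ^ 2 := by linarith
    ring_nf
    rw [e5, e3]
    ring
  rw [this]; positivity

/-! ### The sharp clamped Wirtinger inequality. -/

/-- Completing the square in `u''² - k u²`, given a solution of the associated Riccati system. -/
theorem integral_sq_le_of_riccati {a b k : ℝ} (hab : a ≤ b) {P Q R u u1 u2 : ℝ → ℝ}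
    (hP : ∀ x ∈ Icc a b, HasDerivAt P (-P x ^ 2 - 2 * Q x) x)
    (hQ : ∀ x ∈ Icc a b, HasDerivAt Q (-P x * Q x - R x) x)
    (hR : ∀ x ∈ Icc a b, HasDerivAt R (-k - Q x ^ 2) x)
    (hu : ∀ x, HasDerivAt u (u1 x) x) (hu1 : ∀ x, HasDerivAt u1 (u2 x) x) (hu2 : Continuous u2)
    (ha : u a = 0) (ha1 : u1 a = 0) (hb : u b = 0) (hb1 : u1 b = 0) :
    0 ≤ ∫ x in a..b, (u2 x ^ 2 - k * u x ^ 2) := by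
  have huc : Continuous u := continuous_iff_continuousAt.2 fun x => (hu x).continuousAt
  have hu1c : Continuous u1 := continuous_iff_continuousAt.2 fun x => (hu1 x).continuousAt
  have hPc : ContinuousOn P (Icc a b) := fun x hx => (hP x hx).continuousAt.continuousWithinAt
  have hQc : ContinuousOn Q (Icc a b) := fun x hx => (hQ x hx).continuousAt.continuousWithinAt
  have hsq : ContinuousOn (fun x => (u2 x - P x * u1 x - Q x * u x) ^ 2) (Icc a b) := by
    fun_prop
  have hD : ContinuousOn (fun x => u2 x ^ 2 - k * u x ^ 2 -
      (u2 x - P x * u1 x - Q x * u x) ^ 2) (Icc a b) := by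
    fun_prop
  have hi1 := hsq.intervalIntegrable_of_Icc (μ := volume) hab
  have hi2 := hD.intervalIntegrable_of_Icc (μ := volume) hab
  -- By the Riccati system this integrand is the exact derivative of `P u'² + 2 Q u u' + R u²`,
  -- which vanishes at clamped ends.
  have hFTC : ∫ x in a..b, (u2 x ^ 2 - k * u x ^ 2 - (u2 x - P x * u1 x - Q x * u x) ^ 2) = 0 := by
    rw [intervalIntegral.integral_eq_sub_of_hasDerivAt
      (f := fun x => P x * u1 x ^ 2 + 2 * (Q x * (u x * u1 x)) + R x * u x ^ 2) ?_ hi2]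
    · simp [ha, ha1, hb, hb1]
    · intro x hx
      rw [uIcc_of_le hab] at hx
      refine ((((hP x hx).fun_mul ((hu1 x).fun_pow 2)).fun_add
        (((hQ x hx).fun_mul ((hu x).fun_mul (hu1 x))).const_mul 2)).fun_add
          ((hR x hx).fun_mul ((hu x).fun_pow 2))).congr_deriv ?_
      push_cast
      ring
  have hnn : 0 ≤ ∫ x in a..b, (u2 x - P x * u1 x - Q x * u x) ^ 2 :=
    intervalIntegral.integral_nonneg hab fun x _ => sq_nonneg _
  have : ∫ x in a..b, (u2 x ^ 2 - k * u x ^ 2) =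
      (∫ x in a..b, (u2 x ^ 2 - k * u x ^ 2 - (u2 x - P x * u1 x - Q x * u x) ^ 2)) +
        ∫ x in a..b, (u2 x - P x * u1 x - Q x * u x) ^ 2 := by
    rw [← intervalIntegral.integral_add hi2 hi1]
    simp
  rw [this, hFTC, zero_add]
  exact hnn

/-- Sharp Wirtinger inequality for clamped functions. -/
theorem clamped_wirtinger {a b κ : ℝ} (hab : a ≤ b) (hκ : 0 < κ)
    (hlen : κ * (b - a) < Real.pi * tau ^ (1 / 4 : ℝ)) {u u1 u2 : ℝ → ℝ}
    (hu : ∀ x, HasDerivAt u (u1 x) x) (hu1 : ∀ x, HasDerivAt u1 (u2 x) x) (hu2 : Continuous u2)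
    (ha : u a = 0) (ha1 : u1 a = 0) (hb : u b = 0) (hb1 : u1 b = 0) :
    0 ≤ ∫ x in a..b, (u2 x ^ 2 - κ ^ 4 * u x ^ 2) := by
  -- The determinant vanishes at `0`, so the phase starts at `δ > 0`; the strict inequality in
  -- `hlen` leaves room for this shift.
  obtain ⟨δ, hδ, hδ'⟩ := exists_between (sub_pos.2 hlen)
  set T : ℝ → ℝ := fun x => κ * (x - a) + δ with hT
  have hTd : ∀ x, HasDerivAt T κ x := fun x => 
    ((((hasDerivAt_id' x).sub_const a).const_mul κ).add_const δ).congr_deriv (mul_one κ)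
  -- Half the Wronskian, in the variable `T`, of `cosh T - cos T` and `sinh T - sin T`, the beam
  -- solutions with a double zero at `T = 0`.
  set W : ℝ → ℝ := fun x => 1 - Real.cosh (T x) * Real.cos (T x) with hW
  have hWpos : ∀ x ∈ Icc a b, 0 < W x := fun x hx => by
    refine one_sub_cosh_mul_cos_pos ?_ ?_
    · have : 0 ≤ κ * (x - a) := mul_nonneg hκ.le (by linarith [hx.1])
      simp only [hT]; linarith
    · have : κ * (x - a) ≤ κ * (b - a) := by gcongr; exact hx.2
      simp only [hT]; linarith
  have dsh : ∀ x, HasDerivAt (fun x => Real.sinh (T x)) (Real.cosh (T x) * κ) x :=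
    fun x => (hTd x).sinh
  have dch : ∀ x, HasDerivAt (fun x => Real.cosh (T x)) (Real.sinh (T x) * κ) x :=
    fun x => (hTd x).cosh
  have dsi : ∀ x, HasDerivAt (fun x => Real.sin (T x)) (Real.cos (T x) * κ) x :=
    fun x => (hTd x).sin
  have dco : ∀ x, HasDerivAt (fun x => Real.cos (T x)) (-Real.sin (T x) * κ) x :=
    fun x => (hTd x).cos
  have dW : ∀ x, HasDerivAt W
      (κ * (Real.cosh (T x) * Real.sin (T x) - Real.sinh (T x) * Real.cos (T x))) x := fun x => by
    refine (((dch x).fun_mul (dco x)).const_sub 1).congr_deriv ?_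
    ring
  -- Both of these solutions satisfy `u'' = P u' + Q u` and `u''' = -Q u' - R u`, which determines
  -- the coefficients; in particular `P = W' / W`.
  refine integral_sq_le_of_riccati hab
    (P := fun x => κ * (Real.cosh (T x) * Real.sin (T x) - Real.sinh (T x) * Real.cos (T x)) / W x)
    (Q := fun x => -κ ^ 2 * (Real.sinh (T x) * Real.sin (T x)) / W x)
    (R := fun x => κ ^ 3 *
      (Real.cosh (T x) * Real.sin (T x) + Real.sinh (T x) * Real.cos (T x)) / W x)
    ?_ ?_ ?_ hu hu1 hu2 ha ha1 hb hb1
  · intro x hx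
    have hne := (hWpos x hx).ne'
    refine (((((dch x).fun_mul (dsi x)).fun_sub ((dsh x).fun_mul (dco x))).const_mul κ).fun_div
      (dW x) hne).congr_deriv ?_
    field_simp
    ring
  · intro x hx
    have hne := (hWpos x hx).ne'
    refine ((((dsh x).fun_mul (dsi x)).const_mul (-κ ^ 2)).fun_div (dW x) hne).congr_deriv ?_
    field_simp
    ring
  · intro x hx
    have hne := (hWpos x hx).ne'
    refine (((((dch x).fun_mul (dsi x)).fun_add ((dsh x).fun_mul (dco x))).const_mul (κ ^ 3)).fun_div
      (dW x) hne).congr_deriv ?_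
    have e3 := Real.cosh_sq (T x)
    have e4 := Real.sin_sq (T x)
    rw [div_eq_iff (pow_ne_zero 2 hne)]
    field_simp
    simp only [hW]
    ring_nf
    simp only [e3, e4]
    ring

/-! ### Compactly supported spectra and their entire transforms. -/

/-- Square-integrable functions vanishing outside `[-B, B]`. -/
structure CompactSpectrum (B : ℝ) (g : ℝ → ℂ) : Prop where
  memLp : MemLp g 2 volume
  zero : ∀ ξ, B < |ξ| → g ξ = 0

namespace CompactSpectrum

variable {B : ℝ} {g : ℝ → ℂ}

theorem integrable (hg : CompactSpectrum B g) : Integrable g := by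
  have hon : IntegrableOn g (Icc (-B) B) := by
    rw [IntegrableOn, ← memLp_one_iff_integrable]
    exact (hg.memLp.restrict _).mono_exponent (by norm_num)
  refine hon.integrable_of_forall_notMem_eq_zero fun ξ hξ => hg.zero ξ ?_
  by_contra! h
  exact hξ (abs_le.1 h)

theorem mul_linear (hg : CompactSpectrum B g) (c : ℂ) :
    CompactSpectrum B fun ξ => c * ξ * g ξ := by
  refine ⟨hg.memLp.of_le_mul (c := ‖c‖ * B) ?_ ?_, fun ξ hξ => by simp [hg.zero ξ hξ]⟩
  · exact (by fun_prop : Continuous fun ξ : ℝ => c * (ξ : ℂ)).aestronglyMeasurable.mul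
      hg.memLp.aestronglyMeasurable
  · refine Filter.Eventually.of_forall fun ξ => ?_
    by_cases h : B < |ξ|
    · simp [hg.zero ξ h]
    · rw [norm_mul, norm_mul, Complex.norm_real, Real.norm_eq_abs]
      gcongr
      exact not_lt.1 h

end CompactSpectrum

/-- The Fourier–Laplace transform `z ↦ ∫ e^{2πizξ} g(ξ) dξ`. -/
noncomputable def fourierLaplace (g : ℝ → ℂ) (z : ℂ) : ℂ :=
  ∫ ξ : ℝ, Complex.exp (2 * Real.pi * Complex.I * z * ξ) * g ξ

theorem fourierLaplace_ofReal (g : ℝ → ℂ) (x : ℝ) : fourierLaplace g x = 𝓕⁻ g x := by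
  rw [Real.fourierInv_eq', fourierLaplace]
  refine integral_congr_ae (Filter.Eventually.of_forall fun ξ => ?_)
  simp only [smul_eq_mul]
  congr 2
  simp
  ring

/-- Differentiation under the integral: `|ξ| ≤ B` on the support bounds the exponential uniformly
for `z` in a unit ball. -/
theorem hasDerivAt_fourierLaplace {B : ℝ} {g : ℝ → ℂ} (hg : CompactSpectrum B g) (z : ℂ) :
    HasDerivAt (fourierLaplace g)
      (fourierLaplace (fun ξ => 2 * Real.pi * Complex.I * ξ * g ξ) z) z := by
  have hg1 := hg.mul_linear (2 * Real.pi * Complex.I)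
  have hexp : ∀ z : ℂ, Continuous fun ξ : ℝ =>
      Complex.exp (2 * Real.pi * Complex.I * z * ξ) := fun z => by fun_prop
  have hmeas : ∀ {h : ℝ → ℂ}, CompactSpectrum B h → ∀ z : ℂ, AEStronglyMeasurable
      (fun ξ : ℝ => Complex.exp (2 * Real.pi * Complex.I * z * ξ) * h ξ) volume :=
    fun hh z => (hexp z).aestronglyMeasurable.mul hh.memLp.aestronglyMeasurable
  have hbound : ∀ {h : ℝ → ℂ}, CompactSpectrum B h → ∀ w ∈ Metric.ball z 1, ∀ ξ : ℝ,
      ‖Complex.exp (2 * Real.pi * Complex.I * w * ξ) * h ξ‖ ≤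
        Real.exp (2 * Real.pi * (‖z‖ + 1) * B) * ‖h ξ‖ := by
    intro h hh w hw ξ
    by_cases hξ : B < |ξ|
    · simp [hh.zero ξ hξ]
    · rw [norm_mul]
      gcongr
      rw [Complex.norm_exp]
      gcongr
      have hw' : ‖w‖ ≤ ‖z‖ + 1 := by
        have h1 := norm_sub_norm_le w z
        have h2 := mem_ball_iff_norm.1 hw
        linarith
      calc (2 * Real.pi * Complex.I * w * ξ : ℂ).re ≤ ‖(2 * Real.pi * Complex.I * w * ξ : ℂ)‖ :=
            Complex.re_le_norm _
        _ = 2 * Real.pi * ‖w‖ * |ξ| := by simp [abs_of_pos Real.pi_pos]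
        _ ≤ 2 * Real.pi * (‖z‖ + 1) * B := by
            have := Real.pi_pos
            gcongr
            exact not_lt.1 hξ
  refine (hasDerivAt_integral_of_dominated_loc_of_deriv_le
    (F := fun z (ξ : ℝ) => Complex.exp (2 * Real.pi * Complex.I * z * ξ) * g ξ)
    (F' := fun z (ξ : ℝ) => Complex.exp (2 * Real.pi * Complex.I * z * ξ) *
      (2 * Real.pi * Complex.I * ξ * g ξ))
    (bound := fun ξ => Real.exp (2 * Real.pi * (‖z‖ + 1) * B) *
      ‖2 * Real.pi * Complex.I * ξ * g ξ‖)
    (Metric.ball_mem_nhds z one_pos) (Filter.Eventually.of_forall (hmeas hg))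
    ?_ (hmeas hg1 z) ?_ (hg1.integrable.norm.const_mul _) ?_).2
  · exact (hg.integrable.norm.const_mul _).mono' (hmeas hg z)
      (Filter.Eventually.of_forall fun ξ => hbound hg z (Metric.mem_ball_self one_pos) ξ)
  · exact Filter.Eventually.of_forall fun ξ w hw => hbound hg1 w hw ξ
  · refine Filter.Eventually.of_forall fun ξ w _ => ?_
    have h1 : HasDerivAt (fun w : ℂ => 2 * Real.pi * Complex.I * w * ξ)
        (2 * Real.pi * Complex.I * ξ) w :=
      (((hasDerivAt_id' w).const_mul _).mul_const _).congr_deriv (by ring)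
    exact (h1.cexp.mul_const (g ξ)).congr_deriv (by ring)

theorem differentiable_fourierLaplace {B : ℝ} {g : ℝ → ℂ} (hg : CompactSpectrum B g) :
    Differentiable ℂ (fourierLaplace g) :=
  fun z => (hasDerivAt_fourierLaplace hg z).differentiableAt

/-! ### The inverse Fourier transform on `L²` and Plancherel. -/

theorem continuous_fourierInv {g : ℝ → ℂ} (hg : Integrable g) : Continuous (𝓕⁻ g) :=
  VectorFourier.fourierIntegral_continuous (L := -innerₗ ℝ) Real.continuous_fourierChar
    (continuous_inner (𝕜 := ℝ) (E := ℝ)).neg hg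

theorem integral_fourierInv_mul_eq {φ g : ℝ → ℂ} (hφ : Integrable φ) (hg : Integrable g) :
    ∫ x, 𝓕⁻ φ x * g x = ∫ x, φ x * 𝓕⁻ g x := by
  have h := VectorFourier.integral_fourierIntegral_smul_eq_flip (L := -innerₗ ℝ)
    Real.continuous_fourierChar (continuous_inner (𝕜 := ℝ) (E := ℝ)).neg
    hφ hg
  have hflip : (-innerₗ ℝ : ℝ →ₗ[ℝ] ℝ →ₗ[ℝ] ℝ).flip = -innerₗ ℝ := by
    ext; simp
  rw [hflip] at h
  exact h

/-- The `L²` inverse Fourier transform of an integrable function is given by the integral. -/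
theorem coeFn_fourierInv_toLp {g : ℝ → ℂ} (hg : Integrable g) (hg2 : MemLp g 2 volume) :
    ((𝓕⁻ (hg2.toLp g) : Lp ℂ 2 (volume : Measure ℝ)) : ℝ → ℂ) =ᵐ[volume] 𝓕⁻ g := by
  -- Both sides are tested against smooth compactly supported `φ`; duality moves the transform onto
  -- `φ`, where it is the Schwartz one.
  refine ae_eq_of_integral_contDiff_smul_eq ((Lp.memLp _).locallyIntegrable (by norm_num))
    (continuous_fourierInv hg).locallyIntegrable fun φ hφ hφc => ?_
  have hc : HasCompactSupport (Complex.ofRealCLM ∘ φ) := hφc.comp_left rfl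
  have hs : ContDiff ℝ (⊤ : ℕ∞) (Complex.ofRealCLM ∘ φ) := by fun_prop
  set ψ : SchwartzMap ℝ ℂ := hc.toSchwartzMap hs with hψ
  have hψφ : ∀ x, ψ x = (φ x : ℂ) := fun x => rfl
  have h := congrArg (fun T => T ψ) (Lp.fourierInv_toTemperedDistribution_eq (hg2.toLp g))
  simp only [TemperedDistribution.fourierInv_apply, Lp.toTemperedDistribution_apply] at h
  calc ∫ x, φ x • (𝓕⁻ (hg2.toLp g) : Lp ℂ 2 (volume : Measure ℝ)) x
      = ∫ x, ψ x • (𝓕⁻ (hg2.toLp g) : Lp ℂ 2 (volume : Measure ℝ)) x := by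
        simp [hψφ]
    _ = ∫ x, (𝓕⁻ ψ) x • (hg2.toLp g) x := h.symm
    _ = ∫ x, 𝓕⁻ (ψ : ℝ → ℂ) x * g x := by
        refine integral_congr_ae ?_
        filter_upwards [hg2.coeFn_toLp] with x hx
        rw [hx, SchwartzMap.fourierInv_coe, smul_eq_mul]
    _ = ∫ x, ψ x * 𝓕⁻ g x := integral_fourierInv_mul_eq ψ.integrable hg
    _ = ∫ x, φ x • 𝓕⁻ g x := by simp [hψφ]

theorem Lp_two_norm_sq_eq_integral (F : Lp ℂ 2 (volume : Measure ℝ)) :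
    ‖F‖ ^ 2 = ∫ x, ‖F x‖ ^ 2 := by
  have h : (inner ℂ F F : ℂ) = ∫ x, inner ℂ (F x) (F x) := L2.inner_def F F
  have h2 : (fun x => (inner ℂ (F x) (F x) : ℂ)) = fun x => ((‖F x‖ ^ 2 : ℝ) : ℂ) := by
    funext x
    rw [inner_self_eq_norm_sq_to_K]
    simp
  rw [h2, integral_complex_ofReal, inner_self_eq_norm_sq_to_K] at h
  exact Complex.ofReal_injective (by simpa using h)

theorem memLp_fourierInv {g : ℝ → ℂ} (hg : Integrable g) (hg2 : MemLp g 2 volume) :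
    MemLp (𝓕⁻ g) 2 volume :=
  (memLp_congr_ae (coeFn_fourierInv_toLp hg hg2)).1 (Lp.memLp _)

theorem integral_norm_sq_fourierInv {g : ℝ → ℂ} (hg : Integrable g) (hg2 : MemLp g 2 volume) :
    ∫ x, ‖𝓕⁻ g x‖ ^ 2 = ∫ ξ, ‖g ξ‖ ^ 2 := by
  set G := hg2.toLp g
  have h1 : ∫ x, ‖𝓕⁻ g x‖ ^ 2 = ‖(𝓕⁻ G : Lp ℂ 2 (volume : Measure ℝ))‖ ^ 2 := by
    rw [Lp_two_norm_sq_eq_integral]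
    refine integral_congr_ae ?_
    filter_upwards [coeFn_fourierInv_toLp hg hg2] with x hx
    rw [hx]
  have h2 : ∫ x, ‖g x‖ ^ 2 = ‖G‖ ^ 2 := by
    rw [Lp_two_norm_sq_eq_integral]
    refine integral_congr_ae ?_
    filter_upwards [hg2.coeFn_toLp] with x hx
    rw [hx]
  have h3 : ‖(𝓕⁻ G : Lp ℂ 2 (volume : Measure ℝ))‖ = ‖G‖ :=
    (Lp.fourierTransformₗᵢ ℝ ℂ).symm.norm_map G
  rw [h1, h2, h3]

/-- A band-limited function is the inverse Fourier transform of a compactly supported function. -/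
theorem Bandlimited.exists_spectrum {σ : ℝ} {f : ℝ → ℂ} (hf : f ∈ Bandlimited σ) :
    ∃ g : ℝ → ℂ, CompactSpectrum (σ / (2 * Real.pi)) g ∧ f = 𝓕⁻ g := by
  obtain ⟨hc, hf2, hsupp⟩ := hf
  set F := hf2.toLp f with hF
  set G : Lp ℂ 2 (volume : Measure ℝ) := 𝓕 F with hG
  set B := σ / (2 * Real.pi) with hB
  have hpi := Real.pi_pos
  -- Dilation preserves null sets, so the support condition passes from `ω` to `ξ = ω / 2π`.
  have hq : Measure.QuasiMeasurePreserving (fun ξ : ℝ => 2 * Real.pi * ξ) volume volume := by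
    refine ⟨by fun_prop, ?_⟩
    rw [Real.map_volume_mul_left (by positivity)]
    exact Measure.smul_absolutelyContinuous
  have hG0 : ∀ᵐ ξ : ℝ, B < |ξ| → G ξ = 0 := by
    filter_upwards [hq.ae hsupp] with ξ hξ hlt
    have h2 : angularFourier F (2 * Real.pi * ξ) = G ξ := by
      rw [angularFourier, mul_div_cancel_left₀ _ (by positivity)]
    rw [← h2]
    refine hξ fun hmem => ?_
    have := abs_le.2 hmem
    rw [abs_mul, abs_of_pos (by positivity)] at this
    rw [hB, div_lt_iff₀ (by positivity)] at hlt
    linarith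
  -- Truncation makes the spectrum vanish everywhere, not only almost everywhere, outside the band.
  set g : ℝ → ℂ := (Icc (-B) B).indicator G with hg
  have hgG : g =ᵐ[volume] G := by
    filter_upwards [hG0] with ξ hξ
    by_cases h : ξ ∈ Icc (-B) B
    · simp [hg, h]
    · rw [hg, indicator_of_notMem h, hξ]
      by_contra! h'
      exact h (abs_le.1 h')
  have hgs : CompactSpectrum B g := by
    refine ⟨(memLp_congr_ae hgG).2 (Lp.memLp G), fun ξ hξ => ?_⟩
    refine indicator_of_notMem (fun h => ?_) _
    exact absurd (abs_le.2 h) (not_le.2 hξ)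
  refine ⟨g, hgs, ?_⟩
  have hLp : hgs.memLp.toLp g = G := by
    refine Lp.ext ?_
    exact hgs.memLp.coeFn_toLp.trans hgG
  have h1 := coeFn_fourierInv_toLp hgs.integrable hgs.memLp
  rw [hLp, hG, FourierTransform.fourierInv_fourier_eq] at h1
  have h2 : f =ᵐ[volume] 𝓕⁻ g := hf2.coeFn_toLp.symm.trans h1
  exact (hc.ae_eq_iff_eq volume (continuous_fourierInv hgs.integrable)).1 h2

/-! ### Ingredients of the final argument. -/

/-- Sharp Wirtinger inequality for complex-valued clamped functions. -/
theorem clamped_wirtinger_complex {a b κ : ℝ} (hab : a ≤ b) (hκ : 0 < κ)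
    (hlen : κ * (b - a) < Real.pi * tau ^ (1 / 4 : ℝ)) {u u1 u2 : ℝ → ℂ}
    (hu : ∀ x, HasDerivAt u (u1 x) x) (hu1 : ∀ x, HasDerivAt u1 (u2 x) x) (hu2 : Continuous u2)
    (ha : u a = 0) (ha1 : u1 a = 0) (hb : u b = 0) (hb1 : u1 b = 0) :
    0 ≤ ∫ x in a..b, (‖u2 x‖ ^ 2 - κ ^ 4 * ‖u x‖ ^ 2) := by
  have huc : Continuous u := continuous_iff_continuousAt.2 fun x => (hu x).continuousAt
  have hre := clamped_wirtinger hab hκ hlen (u := fun x => (u x).re) (u1 := fun x => (u1 x).re)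
    (u2 := fun x => (u2 x).re) (fun x => Complex.reCLM.hasFDerivAt.comp_hasDerivAt x (hu x))
    (fun x => Complex.reCLM.hasFDerivAt.comp_hasDerivAt x (hu1 x)) (by fun_prop)
    (by simp [ha]) (by simp [ha1]) (by simp [hb]) (by simp [hb1])
  have him := clamped_wirtinger hab hκ hlen (u := fun x => (u x).im) (u1 := fun x => (u1 x).im)
    (u2 := fun x => (u2 x).im) (fun x => Complex.imCLM.hasFDerivAt.comp_hasDerivAt x (hu x))
    (fun x => Complex.imCLM.hasFDerivAt.comp_hasDerivAt x (hu1 x)) (by fun_prop)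
    (by simp [ha]) (by simp [ha1]) (by simp [hb]) (by simp [hb1])
  have hsum := add_nonneg hre him
  rw [← intervalIntegral.integral_add
    (Continuous.intervalIntegrable (by fun_prop) _ _)
    (Continuous.intervalIntegrable (by fun_prop) _ _)] at hsum
  refine hsum.trans_eq (intervalIntegral.integral_congr fun x _ => ?_)
  simp only [Complex.sq_norm, Complex.normSq_apply]
  ring

/-- An entire function vanishing along a convergent injective real sequence is zero. -/
theorem Differentiable.eq_zero_of_tendsto_real {H : ℂ → ℂ} (hH : Differentiable ℂ H)
    {y : ℕ → ℝ} (hy : Function.Injective y) {L : ℝ} (hL : Filter.Tendsto y Filter.atTop (nhds L))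
    (h0 : ∀ n, H (y n) = 0) : H = 0 := by
  -- By injectivity at most one term equals `L`, so the tail stays in the punctured neighbourhood.
  have hne : ∀ᶠ n in Filter.atTop, ((y n : ℝ) : ℂ) ∈ ({(L : ℂ)}ᶜ : Set ℂ) := by
    by_cases h : ∃ m, y m = L
    · obtain ⟨m, hm⟩ := h
      filter_upwards [Filter.eventually_gt_atTop m] with n hn hmem
      have : y n = y m := by rw [hm]; exact Complex.ofReal_injective hmem
      exact hn.ne' (hy this)
    · exact Filter.Eventually.of_forall fun n hmem => h ⟨n, Complex.ofReal_injective hmem⟩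
  have ht : Filter.Tendsto (fun n => (y n : ℂ)) Filter.atTop (nhdsWithin (L : ℂ) {(L : ℂ)}ᶜ) :=
    tendsto_nhdsWithin_iff.2 ⟨(Complex.continuous_ofReal.tendsto L).comp hL, hne⟩
  have hfreq : ∃ᶠ z in nhdsWithin (L : ℂ) {(L : ℂ)}ᶜ, H z = (0 : ℂ → ℂ) z :=
    ht.frequently (Filter.Frequently.of_forall h0)
  exact AnalyticOnNhd.eq_of_frequently_eq (fun z _ => hH.analyticAt z)
    (fun z _ => analyticAt_const) hfreq

/-- If the spectrum `g` lies in `[-σ/2π, σ/2π]` and `‖f''‖₂ ≥ σ² ‖f‖₂`, then `g = 0` a.e. -/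
theorem CompactSpectrum.ae_eq_zero_of_le {σ : ℝ} {g : ℝ → ℂ}
    (hg : CompactSpectrum (σ / (2 * Real.pi)) g)
    (h : σ ^ 4 * ∫ ξ, ‖g ξ‖ ^ 2 ≤ ∫ ξ, ‖2 * Real.pi * Complex.I * ξ *
      (2 * Real.pi * Complex.I * ξ * g ξ)‖ ^ 2) :
    g =ᵐ[volume] 0 := by
  have hpi := Real.pi_pos
  have hg2 := (hg.mul_linear (2 * Real.pi * Complex.I)).mul_linear (2 * Real.pi * Complex.I)
  have hnorm : ∀ ξ : ℝ, ‖2 * Real.pi * Complex.I * ξ *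
      (2 * Real.pi * Complex.I * ξ * g ξ)‖ ^ 2 = (2 * Real.pi * |ξ|) ^ 4 * ‖g ξ‖ ^ 2 := fun ξ => by
    simp only [norm_mul, Complex.norm_real, Complex.norm_I, Complex.norm_ofNat, Real.norm_eq_abs,
      abs_of_pos hpi]
    ring
  have hint : Integrable fun ξ => ‖g ξ‖ ^ 2 := hg.memLp.integrable_norm_pow two_ne_zero
  have hint2 : Integrable fun ξ : ℝ => ‖2 * Real.pi * Complex.I * ξ *
      (2 * Real.pi * Complex.I * ξ * g ξ)‖ ^ 2 := hg2.memLp.integrable_norm_pow two_ne_zero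
  have hlt : ∀ ξ : ℝ, |ξ| < σ / (2 * Real.pi) → (2 * Real.pi * |ξ|) ^ 4 < σ ^ 4 := fun ξ hξ => by
    rw [lt_div_iff₀ (by positivity)] at hξ
    exact pow_lt_pow_left₀ (by linarith) (by positivity) (by norm_num)
  have hnn : 0 ≤ fun ξ : ℝ => σ ^ 4 * ‖g ξ‖ ^ 2 - ‖2 * Real.pi * Complex.I * ξ *
      (2 * Real.pi * Complex.I * ξ * g ξ)‖ ^ 2 := fun ξ => by
    simp only [Pi.zero_apply, hnorm]
    rcases lt_trichotomy |ξ| (σ / (2 * Real.pi)) with hξ | hξ | hξ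
    · have := mul_le_mul_of_nonneg_right (hlt ξ hξ).le (sq_nonneg ‖g ξ‖)
      linarith
    · rw [hξ, mul_div_cancel₀ _ (by positivity), sub_self]
    · simp [hg.zero ξ hξ]
  have hint3 := (hint.const_mul (σ ^ 4)).sub hint2
  have hzero := (integral_eq_zero_iff_of_nonneg hnn hint3).1 (by
    refine le_antisymm ?_ (integral_nonneg hnn)
    rw [integral_sub (hint.const_mul _) hint2, integral_const_mul]
    linarith)
  -- At the band edges the weight `σ⁴ - (2π|ξ|)⁴` is zero and gives no information, but they form a
  -- null set.
  have hne : ∀ᵐ ξ : ℝ, ξ ∉ ({σ / (2 * Real.pi), -(σ / (2 * Real.pi))} : Set ℝ) :=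
    (Set.toFinite _).countable.ae_notMem _
  filter_upwards [hzero, hne] with ξ h1 h2
  simp only [hnorm, Pi.zero_apply] at h1 ⊢
  rcases lt_trichotomy |ξ| (σ / (2 * Real.pi)) with hξ | hξ | hξ
  · have hprod : (σ ^ 4 - (2 * Real.pi * |ξ|) ^ 4) * ‖g ξ‖ ^ 2 = 0 := by linarith
    rcases mul_eq_zero.1 hprod with h3 | h3
    · linarith [hlt ξ hξ]
    · simpa using h3
  · exact absurd (eq_or_eq_neg_of_abs_eq hξ) h2
  · exact hg.zero ξ hξ

/-! ### Uniqueness from double zeros. -/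

theorem mainTheorem2 (σ : ℝ) (hσ : 0 < σ) (f : ℝ → ℂ) (hf : f ∈ Bandlimited σ)
    (x : ℤ → ℝ) (hx : StrictMono x)
    (hzero : ∀ j : ℤ, f (x j) = 0 ∧ deriv f (x j) = 0)
    (hbdd : BddAbove (Set.range fun j : ℤ => x (j + 1) - x j))
    (hgap : (⨆ j : ℤ, (x (j + 1) - x j)) ≤ Real.pi / σ * tau ^ (1 / 4 : ℝ)) :
    f = 0 := by
  obtain ⟨g, hg, rfl⟩ := Bandlimited.exists_spectrum hf
  have hg1 := hg.mul_linear (2 * Real.pi * Complex.I)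
  have hg2 := hg1.mul_linear (2 * Real.pi * Complex.I)
  set g1 : ℝ → ℂ := fun ξ => 2 * Real.pi * Complex.I * ξ * g ξ with hg1def
  set g2 : ℝ → ℂ := fun ξ => 2 * Real.pi * Complex.I * ξ * g1 ξ with hg2def
  have hderiv : ∀ {h : ℝ → ℂ}, CompactSpectrum (σ / (2 * Real.pi)) h → ∀ t : ℝ,
      HasDerivAt (𝓕⁻ h) (𝓕⁻ (fun ξ : ℝ => 2 * Real.pi * Complex.I * ξ * h ξ) t) t := by
    intro h hh t
    have := (hasDerivAt_fourierLaplace hh t).comp_ofReal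
    simpa only [fourierLaplace_ofReal] using this
  have hd0 : ∀ t, HasDerivAt (𝓕⁻ g) (𝓕⁻ g1 t) t := hderiv hg
  have hd1 : ∀ t, HasDerivAt (𝓕⁻ g1) (𝓕⁻ g2 t) t := hderiv hg1
  have hv0 : ∀ j, 𝓕⁻ g (x j) = 0 := fun j => (hzero j).1
  have hv1 : ∀ j, 𝓕⁻ g1 (x j) = 0 := fun j => by rw [← (hd0 (x j)).deriv]; exact (hzero j).2
  have hacc : ∀ {y : ℕ → ℤ}, Function.Injective y → ∀ {L : ℝ},
      Filter.Tendsto (fun n => x (y n)) Filter.atTop (nhds L) → 𝓕⁻ g = 0 := by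
    intro y hy L hL
    have h := (differentiable_fourierLaplace hg).eq_zero_of_tendsto_real
      (hx.injective.comp hy) hL fun n => by
        rw [fourierLaplace_ofReal]; exact hv0 _
    funext t
    rw [← fourierLaplace_ofReal, h]
    rfl
  have hmono : Monotone fun n : ℕ => x n := fun m n hmn => hx.monotone (by exact_mod_cast hmn)
  have hanti : Antitone fun n : ℕ => x (-n) := fun m n hmn => hx.monotone (by omega)
  -- Each end of the node sequence either diverges or converges; convergence already forces the
  -- function to vanish.
  rcases tendsto_atTop_of_monotone hmono with htop | ⟨L, hL⟩
  swap
  · exact hacc Nat.cast_injective hL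
  rcases tendsto_atTop_of_antitone hanti with hbot | ⟨L, hL⟩
  swap
  · exact hacc (fun m n hmn => by simpa using hmn) hL
  have hτ : 0 < tau ^ (1 / 4 : ℝ) := Real.rpow_pos_of_pos isLeast_tau.1.1 _
  have hpi := Real.pi_pos
  have hint0 : Integrable fun t => ‖𝓕⁻ g t‖ ^ 2 :=
    (memLp_fourierInv hg.integrable hg.memLp).integrable_norm_pow two_ne_zero
  have hint2 : Integrable fun t => ‖𝓕⁻ g2 t‖ ^ 2 :=
    (memLp_fourierInv hg2.integrable hg2.memLp).integrable_norm_pow two_ne_zero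
  -- Taking `κ < σ` turns the non-strict gap bound into the strict one required by the Wirtinger
  -- inequality.
  have hsub : ∀ κ : ℝ, 0 < κ → κ < σ →
      κ ^ 4 * ∫ ξ, ‖g ξ‖ ^ 2 ≤ ∫ ξ, ‖g2 ξ‖ ^ 2 := by
    intro κ hκ hκσ
    have hint : Integrable fun t => ‖𝓕⁻ g2 t‖ ^ 2 - κ ^ 4 * ‖𝓕⁻ g t‖ ^ 2 :=
      hint2.sub (hint0.const_mul _)
    have hstep : ∀ j : ℤ, 0 ≤ ∫ t in x j..x (j + 1),
        (‖𝓕⁻ g2 t‖ ^ 2 - κ ^ 4 * ‖𝓕⁻ g t‖ ^ 2) := by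
      intro j
      refine clamped_wirtinger_complex (hx.monotone (by omega)) hκ ?_ hd0 hd1
        (continuous_fourierInv hg2.integrable) (hv0 _) (hv1 _) (hv0 _) (hv1 _)
      have h1 : x (j + 1) - x j ≤ Real.pi / σ * tau ^ (1 / 4 : ℝ) := (le_ciSup hbdd j).trans hgap
      calc κ * (x (j + 1) - x j) ≤ κ * (Real.pi / σ * tau ^ (1 / 4 : ℝ)) := by gcongr
        _ < σ * (Real.pi / σ * tau ^ (1 / 4 : ℝ)) := by gcongr
        _ = Real.pi * tau ^ (1 / 4 : ℝ) := by field_simp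
    have hsym : ∀ n : ℕ, 0 ≤ ∫ t in x (-n)..x n,
        (‖𝓕⁻ g2 t‖ ^ 2 - κ ^ 4 * ‖𝓕⁻ g t‖ ^ 2) := by
      intro n
      induction n with
      | zero => simp
      | succ n ih =>
        -- Passing from `n` to `n + 1` adds one gap on each side.
        have h1 := hstep (-(n + 1 : ℤ))
        have h2 := hstep n
        rw [show -(n + 1 : ℤ) + 1 = -n by ring] at h1
        push_cast
        rw [← intervalIntegral.integral_add_adjacent_intervals (b := x n)
          hint.intervalIntegrable hint.intervalIntegrable,
          ← intervalIntegral.integral_add_adjacent_intervals (b := x (-n))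
          hint.intervalIntegrable hint.intervalIntegrable]
        positivity
    have hlim := ge_of_tendsto' (intervalIntegral_tendsto_integral hint hbot htop) hsym
    rw [integral_sub hint2 (hint0.const_mul _), integral_const_mul,
      integral_norm_sq_fourierInv hg.integrable hg.memLp,
      integral_norm_sq_fourierInv hg2.integrable hg2.memLp] at hlim
    linarith
  have hle : σ ^ 4 * ∫ ξ, ‖g ξ‖ ^ 2 ≤ ∫ ξ, ‖g2 ξ‖ ^ 2 := by
    have hc : Continuous fun κ : ℝ => κ ^ 4 * ∫ ξ, ‖g ξ‖ ^ 2 := by fun_prop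
    refine le_of_tendsto ((hc.tendsto σ).mono_left (nhdsWithin_le_nhds (s := Iio σ))) ?_
    filter_upwards [self_mem_nhdsWithin, mem_nhdsWithin_of_mem_nhds (Ioi_mem_nhds hσ)]
      with κ h1 h2 using hsub κ h2 h1
  have hg0 := hg.ae_eq_zero_of_le hle
  funext t
  rw [← fourierLaplace_ofReal, fourierLaplace]
  refine integral_eq_zero_of_ae ?_
  filter_upwards [hg0] with ξ hξ
  simp [hξ]
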